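/- Let $D$ be an integral domain with quotient field $K$. A semistar operation on $D$ is a map $\star: E\mapsto E^\star$ from the set of nonzero $D$-submodules of $K$ to itself such that, for all $0\neq x\in K$ and all nonzero $D$-submodules $E,F$ of $K$: $(xE)^\star=xE^\star$; $E\subseteq F$ implies $E^\star\subseteq F^\star$; $E\subseteq E^\star$ and $E^{\star\star}=E^\star$. We put $0^\star:=0$. A nonzero ideal $I$ of $D$ is a quasi-$\star$-ideal if $I^\star\cap D=I$; it is a quasi-$\star$-prime if moreover it is prime, and a quasi-$\star$-maximal ideal if it is maximal among the proper quasi-$\star$-ideals (such an ideal is prime). Let $\operatorname{QSpec}^\star(D)$ and $\operatorname{QMax}^\star(D)$ be the sets of quasi-$\star$-primes and of quasi-$\star$-maximal ideals. Let $\star_f$ be given by $E^{\star_f}=\bigcup\{F^\star : F\subseteq E,\ F \text{ a nonzero finitely generated } D\text{-submodule of } K\}$, and $\widetilde\star$ by $E^{\widetilde\star}=\bigcap\{ED_M : M\in\operatorname{QMax}^{\star_f}(D)\}$ for nonzero $E$ (the empty intersection being $K$); both are semistar operations on $D$. For a prime $P$ which is zero or a quasi-$\star$-prime, $\star\text{-}\operatorname{ht}(P)$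 is the supremum of the lengths of the chains from $(0)$ to $P$ whose nonzero members are quasi-$\star$-primes. Let $\star\text{-}\dim(D)=\sup\{\star\text{-}\operatorname{ht}(P) : P\in\operatorname{QSpec}^\star(D)\}$, which is $0$ if $\operatorname{QSpec}^\star(D)=\emptyset$. A $\star$-valuation overring of $D$ is a valuation ring $V$ with $D\subseteq V\subseteq K$ and quotient field $K$ (where $V=K$ is allowed) such that $F^\star\subseteq FV$ for each nonzero finitely generated $D$-submodule $F$ of $K$; and $\star\text{-}\dim_v(D)$ is the supremum of the Krull dimensions of the $\star$-valuation overrings of $D$. The domain $D$ is a $\star$-Jaffard domain if $\star\text{-}\dim(D)=\star\text{-}\dim_v(D)<\infty$. The domain $D$ satisfies the $\widetilde\star$-dimension inequality formula if for every domain $T\supseteq D$ that is finitely generated as a ring over $D$, and every nonzero prime ideal $Q$ of $T$ such that $(Q\cap D)^{\widetilde\star}\subsetneq D^{\widetilde\star}$, $$\operatorname{ht}(Q)+\operatorname{tr.deg.}_{\mathbb K(Q\cap D)}(\mathbb K(Q))\le \widetilde\star\text{-}\operatorname{ht}(Q\cap D)+\operatorname{tr.deg.}_D(T),$$ where $\mathbb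 K(\cdot)$ denotes the residue field at a prime and $\operatorname{tr.deg.}_D(T)$ is the transcendence degree of the quotient field of $T$ over $K$. **Theorem.** Let $\star$ be a semistar operation on the domain $D$. If $\widetilde\star\text{-}\dim(D)<\infty$ and $D$ satisfies the $\widetilde\star$-dimension inequality formula, then $\widetilde\star\text{-}\dim(D)=\widetilde\star\text{-}\dim_v(D)$, so that $D$ is a $\widetilde\star$-Jaffard domain. -/

import Mathlib

open scoped Pointwise

universe u v w z

/-- A semistar operation on the domain `D` with quotient field `K`: a map `E ↦ E^⋆` on the nonzero
`D`-submodules of `K` such that `(xE)^⋆ = x E^⋆` for all `0 ≠ x ∈ K`, `E ⊆ F` implies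
`E^⋆ ⊆ F^⋆`, `E ⊆ E^⋆` and `E^⋆⋆ = E^⋆`.
The map is extended to the zero submodule by the usual convention `0^⋆ = 0` (which keeps the
laws true); a nonzero `E` has nonzero `E^⋆` because `E ⊆ E^⋆`. -/
structure SemistarOperation (D : Type u) (K : Type v) [CommRing D] [Field K] [Algebra D K] where
  toFun : Submodule D K → Submodule D K
  map_bot : toFun ⊥ = ⊥
  map_smul : ∀ (x : K) (E : Submodule D K), x ≠ 0 → E ≠ ⊥ → toFun (x • E) = x • toFun E
  mono : ∀ E F : Submodule D K, E ≠ ⊥ → E ≤ F → toFun E ≤ toFun F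
  le_star : ∀ E : Submodule D K, E ≠ ⊥ → E ≤ toFun E
  idem : ∀ E : Submodule D K, E ≠ ⊥ → toFun (toFun E) = toFun E

namespace SemistarOperation

section Operations

variable {D : Type u} {K : Type v} [CommRing D] [Field K] [Algebra D K]

instance : CoeFun (SemistarOperation D K) (fun _ => Submodule D K → Submodule D K) := ⟨toFun⟩

theorem mono' (s : SemistarOperation D K) {E F : Submodule D K} (h : E ≤ F) : s E ≤ s F := by
  by_cases hE : E = ⊥
  · rw [hE, s.map_bot]; exact bot_le
  · exact s.mono E F hE h

theorem le_star' (s : SemistarOperation D K) (E : Submodule D K) : E ≤ s E := by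
  by_cases hE : E = ⊥
  · rw [hE]; exact bot_le
  · exact s.le_star E hE

theorem idem' (s : SemistarOperation D K) (E : Submodule D K) : s (s E) = s E := by
  by_cases hE : E = ⊥
  · rw [hE, s.map_bot, s.map_bot]
  · exact s.idem E hE

theorem map_smul' (s : SemistarOperation D K) {x : K} (hx : x ≠ 0) (E : Submodule D K) :
    s (x • E) = x • s E := by
  by_cases hE : E = ⊥
  · rw [hE, s.map_bot, Submodule.smul_bot', s.map_bot]
  · exact s.map_smul x E hx hE

/-- The identity semistar operation `d_D`. -/
def identity (D : Type u) (K : Type v) [CommRing D] [Field K] [Algebra D K] :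
    SemistarOperation D K where
  toFun E := E
  map_bot := rfl
  map_smul _ _ _ _ := rfl
  mono _ _ _ h := h
  le_star _ _ := le_rfl
  idem _ _ := rfl

/-- The union of the `F^⋆`, over all finitely generated `F ⊆ E` (the submodule `F = 0`, which is
also admitted here, contributes only `0`). -/
def unionFG (s : SemistarOperation D K) (E : Submodule D K) : Submodule D K where
  carrier := {x | ∃ F : Submodule D K, F.FG ∧ F ≤ E ∧ x ∈ s F}
  zero_mem' := ⟨⊥, Submodule.fg_bot, bot_le, zero_mem _⟩
  add_mem' := by
    rintro a b ⟨F, hF, hFE, ha⟩ ⟨G, hG, hGE, hb⟩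
    exact ⟨F ⊔ G, hF.sup hG, sup_le hFE hGE,
      add_mem (s.mono' le_sup_left ha) (s.mono' le_sup_right hb)⟩
  smul_mem' := by
    rintro c x ⟨F, hF, hFE, hx⟩
    exact ⟨F, hF, hFE, Submodule.smul_mem _ c hx⟩

theorem mem_unionFG (s : SemistarOperation D K) (E : Submodule D K) (x : K) :
    x ∈ s.unionFG E ↔ ∃ F : Submodule D K, F.FG ∧ F ≤ E ∧ x ∈ s F := Iff.rfl

theorem exists_of_le_unionFG (s : SemistarOperation D K) (E G : Submodule D K) (hG : G.FG)
    (h : G ≤ s.unionFG E) : ∃ F : Submodule D K, F.FG ∧ F ≤ E ∧ G ≤ s F := by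
  induction G, hG using Submodule.fg_induction with
  | singleton x =>
    obtain ⟨F, hF, hFE, hx⟩ := h (Submodule.mem_span_singleton_self x)
    exact ⟨F, hF, hFE, (Submodule.span_singleton_le_iff_mem _ _).2 hx⟩
  | sup M N _ _ hM hN =>
    obtain ⟨F, hF, hFE, h1⟩ := hM (le_sup_left.trans h)
    obtain ⟨F', hF', hFE', h2⟩ := hN (le_sup_right.trans h)
    exact ⟨F ⊔ F', hF.sup hF', sup_le hFE hFE',
      sup_le (h1.trans (s.mono' le_sup_left)) (h2.trans (s.mono' le_sup_right))⟩

theorem smul_unionFG_le (s : SemistarOperation D K) {x : K} (hx : x ≠ 0) (E : Submodule D K) :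
    x • s.unionFG E ≤ s.unionFG (x • E) := by
  intro y hy
  obtain ⟨z, ⟨F, hF, hFE, hz⟩, rfl⟩ := (Submodule.mem_smul_pointwise_iff_exists _ _ _).1 hy
  refine ⟨x • F, hF.map _, Submodule.map_mono hFE, ?_⟩
  rw [s.map_smul' hx]
  exact Submodule.smul_mem_pointwise_smul _ _ _ hz

/-- The semistar operation of finite type `⋆_f` associated to `⋆`. -/
def finiteType (s : SemistarOperation D K) : SemistarOperation D K where
  toFun := s.unionFG
  map_bot := by
    rw [eq_bot_iff]
    rintro x ⟨F, _, hF, hx⟩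
    rw [le_bot_iff.1 hF, s.map_bot] at hx
    exact hx
  map_smul := by
    intro x E hx _
    refine le_antisymm ?_ (s.smul_unionFG_le hx E)
    have h := s.smul_unionFG_le (inv_ne_zero hx) (x • E)
    rw [inv_smul_smul₀ hx] at h
    have h2 : x • x⁻¹ • s.unionFG (x • E) ≤ x • s.unionFG E := Submodule.map_mono h
    rwa [smul_inv_smul₀ hx] at h2
  mono := by
    rintro E F _ h x ⟨G, hG, hGE, hx⟩
    exact ⟨G, hG, hGE.trans h, hx⟩
  le_star := by
    intro E _ x hx
    exact ⟨Submodule.span D {x}, Submodule.fg_span_singleton x,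
      (Submodule.span_singleton_le_iff_mem _ _).2 hx,
      s.le_star' _ (Submodule.mem_span_singleton_self x)⟩
  idem := by
    intro E _
    refine le_antisymm ?_ ?_
    · rintro x ⟨G, hG, hGE, hx⟩
      obtain ⟨F, hF, hFE, h⟩ := s.exists_of_le_unionFG E G hG hGE
      refine ⟨F, hF, hFE, ?_⟩
      have := s.mono' h hx
      rwa [s.idem'] at this
    · intro x hx
      exact ⟨Submodule.span D {x}, Submodule.fg_span_singleton x,
        (Submodule.span_singleton_le_iff_mem _ _).2 hx,
        s.le_star' _ (Submodule.mem_span_singleton_self x)⟩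

/-- `I` is a quasi-`⋆`-ideal of `D`: it is nonzero and `I^⋆ ∩ D = I`. -/
def IsQuasiIdeal (s : SemistarOperation D K) (I : Ideal D) : Prop :=
  I ≠ ⊥ ∧
    (s (IsLocalization.coeSubmodule K I)).comap (Algebra.linearMap D K) = I

/-- `P` is a quasi-`⋆`-prime ideal of `D`. -/
def IsQuasiPrime (s : SemistarOperation D K) (P : Ideal D) : Prop :=
  P.IsPrime ∧ s.IsQuasiIdeal P

/-- `M` is a quasi-`⋆`-maximal ideal of `D`: it is maximal among the proper
quasi-`⋆`-ideals of `D`. -/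
def IsQuasiMaximal (s : SemistarOperation D K) (M : Ideal D) : Prop :=
  Maximal (fun I : Ideal D => s.IsQuasiIdeal I ∧ I ≠ ⊤) M

/-- The set `QSpec^⋆(D)` of the quasi-`⋆`-prime ideals of `D`. -/
def QSpec (s : SemistarOperation D K) : Set (PrimeSpectrum D) :=
  {P | s.IsQuasiPrime P.asIdeal}

/-- The set `QMax^⋆(D)` of the quasi-`⋆`-maximal ideals of `D`, as a set of prime ideals
(every quasi-`⋆`-maximal ideal is prime, see `SemistarOperation.IsQuasiMaximal.isPrime`). -/
def QMax (s : SemistarOperation D K) : Set (PrimeSpectrum D) :=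
  {M | s.IsQuasiMaximal M.asIdeal}

/-- The `⋆`-height of a prime `P`: the supremum of the lengths of the chains
`(0) ⊂ P₁ ⊂ ⋯ ⊂ Pₙ ⊆ P` in which every `Pᵢ` is a quasi-`⋆`-prime ideal. -/
noncomputable def height (s : SemistarOperation D K) (P : PrimeSpectrum D) : ℕ∞ :=
  ⨆ (c : LTSeries {Q : PrimeSpectrum D // Q.asIdeal = ⊥ ∨ Q ∈ s.QSpec}) (_ : c.last.1 ≤ P),
    (c.length : ℕ∞)

/-- The `⋆`-dimension of `D`: the supremum of the `⋆`-heights of the quasi-`⋆`-primes of `D`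
(and `0` if there are none). -/
noncomputable def dim (s : SemistarOperation D K) : ℕ∞ :=
  ⨆ P ∈ s.QSpec, s.height P

/-- `V` is a `⋆`-valuation overring of `D`: a valuation ring with `D ⊆ V ⊆ K` such that
`F^⋆ ⊆ FV` for each nonzero finitely generated fractional ideal `F` of `D`. (A finitely generated
`D`-submodule of the quotient field is automatically a fractional ideal.) -/
def IsValuationOverring (s : SemistarOperation D K) (V : ValuationSubring K) : Prop :=
  (∀ d : D, algebraMap D K d ∈ V) ∧
    ∀ F : Submodule D K, F.FG → F ≠ ⊥ → (s F : Set K) ⊆ Submodule.span V (F : Set K)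

/-- The `⋆`-valuative dimension of `D`: the supremum of the Krull dimensions of the `⋆`-valuation
overrings of `D`. -/
noncomputable def valuativeDim (s : SemistarOperation D K) : WithBot ℕ∞ :=
  ⨆ (V : ValuationSubring K) (_ : s.IsValuationOverring V), ringKrullDim V

/-- `D` is a `⋆`-Jaffard domain: its `⋆`-dimension and its `⋆`-valuative dimension coincide and
are finite. -/
def IsJaffard (s : SemistarOperation D K) : Prop :=
  (s.dim : WithBot ℕ∞) = s.valuativeDim ∧ s.valuativeDim < ⊤

theorem IsQuasiMaximal.isPrime {s : SemistarOperation D K} {M : Ideal D}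
    (hM : s.IsQuasiMaximal M) : M.IsPrime := by
  refine ⟨hM.prop.2, ?_⟩
  intro a b hab
  by_contra! hcon
  obtain ⟨ha, hb⟩ := hcon
  have ha0 : a ≠ 0 := fun h => ha (h ▸ M.zero_mem)
  let J : Ideal D := Submodule.comap (LinearMap.mulLeft D a) M
  have hJ : ∀ x, x ∈ J ↔ a * x ∈ M := fun x => Iff.rfl
  have hMJ : M ≤ J := fun x hx => (hJ x).2 (M.mul_mem_left a hx)
  have hle : algebraMap D K a • IsLocalization.coeSubmodule K J ≤
      IsLocalization.coeSubmodule K M := by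
    intro y hy
    obtain ⟨z, hz, rfl⟩ := (Submodule.mem_smul_pointwise_iff_exists _ _ _).1 hy
    obtain ⟨x, hx, rfl⟩ := (IsLocalization.mem_coeSubmodule K J).1 hz
    exact (IsLocalization.mem_coeSubmodule K M).2 ⟨a * x, hx, by simp⟩
  have hJq : s.IsQuasiIdeal J := by
    refine ⟨fun h => hM.prop.1.1 (le_bot_iff.1 (h ▸ hMJ)), le_antisymm ?_ ?_⟩
    · intro x hx
      rw [hJ]
      have hx' : algebraMap D K x ∈ s (IsLocalization.coeSubmodule K J) := hx
      have : algebraMap D K (a * x) ∈ s (IsLocalization.coeSubmodule K M) := by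
        by_cases h0 : algebraMap D K a = 0
        · rw [map_mul, h0, zero_mul]; exact zero_mem _
        · have h1 := Submodule.smul_mem_pointwise_smul _ (algebraMap D K a) _ hx'
          rw [← s.map_smul' h0] at h1
          simpa using s.mono' hle h1
      have h2 : a * x ∈ (s (IsLocalization.coeSubmodule K M)).comap (Algebra.linearMap D K) := this
      rwa [hM.prop.1.2] at h2
    · intro x hx
      exact s.le_star' _ ((IsLocalization.mem_coeSubmodule K J).2 ⟨x, hx, rfl⟩)
  have hJt : J ≠ ⊤ := by
    intro h
    have : (1 : D) ∈ J := h ▸ Submodule.mem_top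
    rw [hJ, mul_one] at this
    exact ha this
  exact hb (hM.le_of_ge ⟨hJq, hJt⟩ hMJ ((hJ b).2 hab))

end Operations

section Spectral

variable {D : Type u} {K : Type v} [CommRing D] [IsDomain D] [Field K] [Algebra D K]
  [IsFractionRing D K]

/-- The localization `D_P`, as a subring of the quotient field `K`. -/
noncomputable def localizationAt (K : Type v) [Field K] [Algebra D K] [IsFractionRing D K]
    (P : PrimeSpectrum D) : Subalgebra D K :=
  Localization.subalgebra.ofField K P.asIdeal.primeCompl P.asIdeal.primeCompl_le_nonZeroDivisors

/-- The extension `E D_P` of a `D`-submodule `E` of `K`. -/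
noncomputable def extendAt (P : PrimeSpectrum D) (E : Submodule D K) : Submodule D K :=
  E * Subalgebra.toSubmodule (localizationAt K P)

theorem mem_extendAt (P : PrimeSpectrum D) (E : Submodule D K) (x : K) :
    x ∈ extendAt P E ↔ ∃ t : D, t ∉ P.asIdeal ∧ t • x ∈ E := by
  constructor
  · intro hx
    refine Submodule.mul_induction_on hx ?_ ?_
    · rintro e he y ⟨a, t, ht, rfl⟩
      have ht0 : algebraMap D K t ≠ 0 := by
        intro h
        rw [FaithfulSMul.algebraMap_eq_zero_iff] at h
        exact ht (h ▸ P.asIdeal.zero_mem)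
      refine ⟨t, ht, ?_⟩
      have : t • (e * (algebraMap D K a * (algebraMap D K t)⁻¹)) = a • e := by
        simp only [Algebra.smul_def]
        field_simp
      rw [this]
      exact E.smul_mem a he
    · rintro x y ⟨t, ht, hx⟩ ⟨r, hr, hy⟩
      refine ⟨t * r, P.asIdeal.primeCompl.mul_mem ht hr, ?_⟩
      rw [smul_add]
      refine E.add_mem ?_ ?_
      · rw [mul_comm, mul_smul]; exact E.smul_mem r hx
      · rw [mul_smul]; exact E.smul_mem t hy
  · rintro ⟨t, ht, hx⟩
    have ht0 : algebraMap D K t ≠ 0 := by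
      intro h
      rw [FaithfulSMul.algebraMap_eq_zero_iff] at h
      exact ht (h ▸ P.asIdeal.zero_mem)
    have h : x = (t • x) * (algebraMap D K 1 * (algebraMap D K t)⁻¹) := by
      simp only [Algebra.smul_def, map_one]
      field_simp
    rw [h]
    exact Submodule.mul_mem_mul hx ⟨1, t, ht, rfl⟩

theorem extendAt_smul (P : PrimeSpectrum D) {x : K} (hx : x ≠ 0) (E : Submodule D K) :
    extendAt P (x • E) = x • extendAt P E := by
  ext y
  rw [Submodule.mem_smul_pointwise_iff_exists, mem_extendAt]
  constructor
  · rintro ⟨t, ht, h⟩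
    obtain ⟨e, he, hey⟩ := (Submodule.mem_smul_pointwise_iff_exists _ _ _).1 h
    refine ⟨x⁻¹ • y, (mem_extendAt P E _).2 ⟨t, ht, ?_⟩, smul_inv_smul₀ hx y⟩
    rw [smul_comm, ← hey, inv_smul_smul₀ hx]
    exact he
  · rintro ⟨z, hz, rfl⟩
    obtain ⟨t, ht, h⟩ := (mem_extendAt P E z).1 hz
    refine ⟨t, ht, ?_⟩
    rw [smul_comm]
    exact Submodule.smul_mem_pointwise_smul _ _ _ h

open Classical in
/-- The spectral semistar operation `⋆_Δ` associated to a set `Δ` of prime ideals: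
`E ↦ ⋂ {E D_P | P ∈ Δ}` for nonzero `E`, where the empty intersection is `K`. -/
noncomputable def spectral (Δ : Set (PrimeSpectrum D)) : SemistarOperation D K where
  toFun E := if E = ⊥ then ⊥ else ⨅ P ∈ Δ, extendAt P E
  map_bot := if_pos rfl
  map_smul := by
    intro x E hx hE
    have hxE : x • E ≠ ⊥ := by
      intro h
      apply hE
      rw [← inv_smul_smul₀ hx E, h, Submodule.smul_bot']
    rw [if_neg hxE, if_neg hE]
    ext y
    have key : ∀ (S : Submodule D K), y ∈ x • S ↔ x⁻¹ • y ∈ S := by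
      intro S
      constructor
      · intro h
        obtain ⟨z, hz, rfl⟩ := (Submodule.mem_smul_pointwise_iff_exists _ _ _).1 h
        rwa [inv_smul_smul₀ hx]
      · intro h
        have := Submodule.smul_mem_pointwise_smul _ x _ h
        rwa [smul_inv_smul₀ hx] at this
    simp only [key, Submodule.mem_iInf, extendAt_smul _ hx]
  mono := by
    intro E F hE h
    have hF : F ≠ ⊥ := fun h' => hE (le_bot_iff.1 (h' ▸ h))
    rw [if_neg hE, if_neg hF]
    exact iInf₂_mono fun P _ => mul_le_mul' h le_rfl
  le_star := by
    intro E hE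
    rw [if_neg hE]
    refine le_iInf₂ fun P _ x hx => (mem_extendAt P E x).2 ⟨1, ?_, by simpa using hx⟩
    exact fun h => P.isPrime.ne_top ((Ideal.eq_top_iff_one _).2 h)
  idem := by
    intro E hE
    rw [if_neg hE]
    have hle : E ≤ ⨅ P ∈ Δ, extendAt P E := by
      refine le_iInf₂ fun P _ x hx => (mem_extendAt P E x).2 ⟨1, ?_, by simpa using hx⟩
      exact fun h => P.isPrime.ne_top ((Ideal.eq_top_iff_one _).2 h)
    have hne : (⨅ P ∈ Δ, extendAt P E) ≠ ⊥ := fun h => hE (le_bot_iff.1 (h ▸ hle))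
    rw [if_neg hne]
    refine le_antisymm ?_ (iInf₂_mono fun P _ => mul_le_mul' hle le_rfl)
    refine le_iInf₂ fun P hP x hx => ?_
    obtain ⟨t, ht, h⟩ := (mem_extendAt P _ x).1 ((Submodule.mem_iInf _).1
      ((Submodule.mem_iInf _).1 hx P) hP)
    obtain ⟨r, hr, h'⟩ := (mem_extendAt P E _).1 ((Submodule.mem_iInf _).1
      ((Submodule.mem_iInf _).1 h P) hP)
    refine (mem_extendAt P E x).2 ⟨r * t, P.asIdeal.primeCompl.mul_mem hr ht, ?_⟩
    rwa [mul_smul]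

/-- The semistar operation `⋆̃ = ⋆_Δ` associated to `⋆`, where `Δ = QMax^{⋆_f}(D)`. -/
noncomputable def tilde (s : SemistarOperation D K) : SemistarOperation D K :=
  spectral s.finiteType.QMax

end Spectral

end SemistarOperation

/-- `tr.deg._D(T)` for an extension of domains `D ⊆ T`: the transcendence degree of the quotient
field of `T` over the quotient field of `D` (with `⊤` for any infinite value). -/
noncomputable def extensionTrdeg (D : Type u) (T : Type w) [CommRing D] [IsDomain D]
    [CommRing T] [IsDomain T] [Algebra D T] [FaithfulSMul D T] : ℕ∞ :=
  letI : Algebra (FractionRing D) (FractionRing T) :=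
    FractionRing.liftAlgebra D (FractionRing T)
  Cardinal.toENat (Algebra.trdeg (FractionRing D) (FractionRing T))

/-- The transcendence degree of the residue field of `T` at a prime `Q` over the residue field of
`D` at `Q ∩ D` (with `⊤` for any infinite value). -/
noncomputable def residueTrdeg (D : Type u) {T : Type w} [CommRing D] [CommRing T] [Algebra D T]
    (Q : PrimeSpectrum T) : ℕ∞ :=
  letI : Algebra (Q.asIdeal.under D).ResidueField Q.asIdeal.ResidueField :=
    (Ideal.ResidueField.map (Q.asIdeal.under D) Q.asIdeal (algebraMap D T) rfl).toAlgebra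
  Cardinal.toENat (Algebra.trdeg (Q.asIdeal.under D).ResidueField Q.asIdeal.ResidueField)

/-- The extension of domains `D ⊆ T`, with semistar operations `⋆` on `D` and `⋆'` on `T`,
satisfies the `(⋆, ⋆')`-dimension inequality formula: for all `Q ∈ QSpec^{⋆'}(T)` with
`(Q ∩ D)^⋆ ⊊ D^⋆`,
`⋆'-ht(Q) + tr.deg._{K(Q ∩ D)}(K(Q)) ≤ ⋆-ht(Q ∩ D) + tr.deg._D(T)`. -/
def SatisfiesDimensionInequality {D : Type u} {K : Type v} {T : Type w} {L : Type z}
    [CommRing D] [IsDomain D] [Field K] [Algebra D K] [CommRing T] [IsDomain T]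
    [Field L] [Algebra T L] [Algebra D T] [FaithfulSMul D T]
    (s : SemistarOperation D K) (s' : SemistarOperation T L) : Prop :=
  ∀ Q ∈ s'.QSpec,
    s (IsLocalization.coeSubmodule K (Q.asIdeal.under D)) <
      s (IsLocalization.coeSubmodule K (⊤ : Ideal D)) →
    s'.height Q + residueTrdeg D Q ≤
      s.height (PrimeSpectrum.comap (algebraMap D T) Q) + extensionTrdeg D T

/-- `D` satisfies the `⋆`-dimension inequality formula: for every domain `T ⊇ D` that is finitely
generated as a ring over `D`, the extension `D ⊆ T` satisfies the `(⋆, d_T)`-dimension inequality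
formula. (A finitely generated algebra over `D` is isomorphic to one in the universe of `D`.) -/
def SemistarOperation.DimensionInequalityFormula {D : Type u} {K : Type v} [CommRing D]
    [IsDomain D] [Field K] [Algebra D K] (s : SemistarOperation D K) : Prop :=
  ∀ (T : Type u) [CommRing T] [IsDomain T] [Algebra D T] [FaithfulSMul D T]
    [Algebra.FiniteType D T],
    SatisfiesDimensionInequality s (SemistarOperation.identity T (FractionRing T))

/-! Both inequalities pass between chains of primes of `D` and chains of primes of a valuation ring.
For `dim ≤ valuativeDim`, valid for every spectral operation, a chain from zero to `P ⊆ M` with `M ∈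
Δ` is lifted one step at a time: a valuation ring is centered at `P₁`, then composed with a
valuation ring of its residue field obtained from the rest of the chain (`exists_center_of_chain`).
Elements outside `M` become units of the result, which makes it a `⋆_Δ`-valuation overring.

For `valuativeDim ≤ dim`, a chain of length `n > 0` in a `⋆̃`-valuation overring `V` stays strict on
some finitely generated `T` with `D ⊆ T ⊆ V` (`exists_subalgebra_strictMono`). Let `Q` be its top
prime in `T`. Then `Q ∩ D` is nonzero because `T ⊆ K`, and it lies in the center of `V`, hence in a
quasi-`⋆_f`-maximal ideal (`exists_center_le_QMax`), so it is a quasi-`⋆̃`-prime. As `T` is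
algebraic over `D`, the formula gives `n ≤ ht(Q) ≤ ⋆̃-ht(Q ∩ D)`. -/

section

/-! ### Valuation rings with prescribed center, and their composition -/

open IsLocalRing

/-- A ring homomorphism `f : D →+* K` to a field with `ker f ≤ P` admits a valuation subring of
`K` that contains the image of `f` and is centered at `P`. -/
theorem ValuationSubring.exists_center {D : Type u} {K : Type v} [CommRing D] [Field K]
    (f : D →+* K) (P : Ideal D) [P.IsPrime] (hf : RingHom.ker f ≤ P) :
    ∃ (V : ValuationSubring K) (hV : ∀ d, f d ∈ V),
      ∀ d, (⟨f d, hV d⟩ : V) ∈ maximalIdeal V ↔ d ∈ P := by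
  have hu : ∀ y : P.primeCompl, IsUnit (f y) := fun y =>
    isUnit_iff_ne_zero.2 fun h => y.2 (hf h)
  let g : Localization.AtPrime P →+* K := IsLocalization.lift (M := P.primeCompl) hu
  have hg : ∀ d, g (algebraMap D _ d) = f d := fun d => IsLocalization.lift_eq hu d
  -- A valuation ring dominating the local ring `g(D_P)`; domination forces the center to be `P`
  -- itself.
  obtain ⟨V, hle, hloc⟩ := (LocalSubring.range g).exists_le_valuationSubring
  have hgV : ∀ a, g a ∈ V := fun a => hle (by
    rw [LocalSubring.range_toSubring]; exact ⟨a, rfl⟩)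
  refine ⟨V, fun d => hg d ▸ hgV _, fun d => ?_⟩
  rw [mem_maximalIdeal, _root_.mem_nonunits_iff, ← not_iff_not, not_not]
  constructor
  · intro h hd
    have hr : f d ∈ (LocalSubring.range g).toSubring := by
      rw [LocalSubring.range_toSubring]; exact ⟨_, hg d⟩
    obtain ⟨⟨b, hb⟩, hab⟩ := isUnit_iff_exists_inv.1 (hloc.map_nonunit ⟨f d, hr⟩ h)
    rw [LocalSubring.range_toSubring] at hb
    obtain ⟨a, rfl⟩ := hb
    have hab' : f d * g a = 1 := congrArg Subtype.val hab
    -- Now `1 - d * a` is a unit of `D_P`, since `d ∈ P`, yet `g` sends it to zero.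
    have hm : algebraMap D (Localization.AtPrime P) d * a ∈
        maximalIdeal (Localization.AtPrime P) :=
      Ideal.mul_mem_right _ _ ((IsLocalization.AtPrime.to_map_mem_maximal_iff _ P d).2 hd)
    have hun : IsUnit (1 - algebraMap D (Localization.AtPrime P) d * a) := by
      by_contra hcon
      exact (maximalIdeal.isMaximal (Localization.AtPrime P)).ne_top
        ((Ideal.eq_top_iff_one _).2 (by
          simpa using Ideal.add_mem _ ((mem_maximalIdeal _).2 hcon) hm))
    have := hun.map g
    rw [map_sub, map_one, map_mul, hg, hab', sub_self] at this
    exact not_isUnit_zero this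
  · intro hd
    have hun := IsLocalization.map_units (Localization.AtPrime P)
      (⟨d, hd⟩ : P.primeCompl)
    obtain ⟨b, hb⟩ := isUnit_iff_exists_inv.1 hun
    refine isUnit_iff_exists_inv.2 ⟨⟨g b, hgV b⟩, Subtype.ext ?_⟩
    have := congrArg g hb
    rwa [map_mul, hg, map_one] at this

/-- The composite of a valuation subring `V` of `K` with a valuation subring `W` of the residue
field of `V`: the elements of `V` whose residue lies in `W`. -/
def ValuationSubring.composite {K : Type v} [Field K] (V : ValuationSubring K)
    (W : ValuationSubring (ResidueField V)) : ValuationSubring K where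
  toSubring := (W.toSubring.comap (residue V)).map V.subtype
  mem_or_inv_mem' := by
    intro x
    -- A nonunit of `V` has residue zero, which lies in `W`; only units of `V` need the valuation
    -- property of `W`.
    have key : ∀ x : K, x ∈ V → x⁻¹ ∉ V → x ∈ (W.toSubring.comap (residue V)).map V.subtype := by
      intro x hx hx'
      refine ⟨⟨x, hx⟩, ?_, rfl⟩
      have : residue V ⟨x, hx⟩ = 0 := by
        rw [residue_eq_zero_iff, mem_maximalIdeal, _root_.mem_nonunits_iff]
        intro hu
        obtain ⟨⟨b, hb⟩, hab⟩ := isUnit_iff_exists_inv.1 hu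
        have hab' : x * b = 1 := congrArg Subtype.val hab
        rw [← eq_inv_of_mul_eq_one_right hab'] at hx'
        exact hx' hb
      change residue V ⟨x, hx⟩ ∈ W
      rw [this]
      exact zero_mem W
    by_cases hx : x ∈ V
    · by_cases hx' : x⁻¹ ∈ V
      · by_cases h0 : x = 0
        · left; rw [h0]; exact Subring.zero_mem _
        have hinv : residue V ⟨x⁻¹, hx'⟩ = (residue V ⟨x, hx⟩)⁻¹ := by
          refine eq_inv_of_mul_eq_one_left ?_
          rw [← map_mul, ← map_one (residue V)]
          exact congrArg _ (Subtype.ext (inv_mul_cancel₀ h0))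
        rcases W.mem_or_inv_mem (residue V ⟨x, hx⟩) with h | h
        · exact Or.inl ⟨⟨x, hx⟩, h, rfl⟩
        · exact Or.inr ⟨⟨x⁻¹, hx'⟩, by rw [← hinv] at h; exact h, rfl⟩
      · exact Or.inl (key x hx hx')
    · have hx' := (V.mem_or_inv_mem x).resolve_left hx
      exact Or.inr (key _ hx' (by rwa [inv_inv]))

namespace ValuationSubring

variable {K : Type v} [Field K] (V : ValuationSubring K) (W : ValuationSubring (ResidueField V))

theorem composite_le : V.composite W ≤ V := by
  rintro _ ⟨x, _, rfl⟩
  exact x.2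

theorem mem_composite_iff {x : V} : (x : K) ∈ V.composite W ↔ residue V x ∈ W := by
  constructor
  · rintro ⟨y, hy, h⟩
    have : y = x := Subtype.ext h
    exact this ▸ hy
  · intro h
    exact ⟨x, h, rfl⟩

/-- The residue map from the composite of `V` and `W` to `W`. -/
noncomputable def compositeResidue : V.composite W →+* W :=
  ((residue V).comp (Subring.inclusion (V.composite_le W))).codRestrict W.toSubring fun x =>
    (V.mem_composite_iff W (x := ⟨x, V.composite_le W x.2⟩)).1 x.2

theorem coe_compositeResidue (x : V.composite W) :
    (V.compositeResidue W x : ResidueField V) = residue V ⟨x, V.composite_le W x.2⟩ := rfl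

theorem compositeResidue_surjective : Function.Surjective (V.compositeResidue W) := by
  rintro ⟨y, hy⟩
  obtain ⟨x, rfl⟩ := residue_surjective y
  exact ⟨⟨x, (V.mem_composite_iff W).2 hy⟩, rfl⟩

/-- A nonzero residue makes `x` a unit of `V`, and the residue of its inverse is the inverse in `W`,
so that inverse lies in the composite. Hence the composite has the same center on `D` as `W`. -/
theorem isUnit_compositeResidue_iff (x : V.composite W) :
    IsUnit (V.compositeResidue W x) ↔ IsUnit x := by
  refine ⟨fun h => ?_, fun h => h.map _⟩
  obtain ⟨b, hb⟩ := isUnit_iff_exists_inv.1 h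
  have hne : residue V ⟨x, V.composite_le W x.2⟩ ≠ 0 := by
    intro h0
    have := congrArg Subtype.val hb
    rw [MulMemClass.coe_mul, coe_compositeResidue, h0, zero_mul] at this
    exact zero_ne_one this
  rw [residue_ne_zero_iff_isUnit] at hne
  obtain ⟨y, hy⟩ := isUnit_iff_exists_inv.1 hne
  have hxy : (x : K) * y = 1 := congrArg Subtype.val hy
  have hres : residue V y = b := by
    have h1 : residue V ⟨x, V.composite_le W x.2⟩ * residue V y = 1 := by
      rw [← map_mul, hy, map_one]
    have h2 : residue V ⟨x, V.composite_le W x.2⟩ * b = 1 := congrArg Subtype.val hb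
    exact mul_left_cancel₀ (left_ne_zero_of_mul_eq_one h1) (h1.trans h2.symm)
  exact isUnit_iff_exists_inv.2
    ⟨⟨y, (V.mem_composite_iff W).2 (hres ▸ b.2)⟩, Subtype.ext hxy⟩

/-- A strict chain of primes `P₀ = ker f ⊂ P₁ ⊂ ⋯ ⊂ Pₙ` of `D`, where `f : D →+* K`, is dominated
by a valuation subring of `K` of dimension at least `n` that is centered at `Pₙ`. -/
theorem exists_center_of_chain {D : Type u} [CommRing D] (n : ℕ) :
    ∀ {K : Type v} [Field K] (f : D →+* K) (P : Fin (n + 1) → PrimeSpectrum D),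
      StrictMono P → RingHom.ker f = (P 0).asIdeal →
      ∃ (V : ValuationSubring K) (hV : ∀ d, f d ∈ V),
        (∀ d, (⟨f d, hV d⟩ : V) ∈ maximalIdeal V ↔ d ∈ (P (Fin.last n)).asIdeal) ∧
          (n : WithBot ℕ∞) ≤ ringKrullDim V := by
  induction n with
  | zero =>
    intro K _ f P _ hker
    obtain ⟨V, hV, hV'⟩ := exists_center f (P 0).asIdeal hker.le
    exact ⟨V, hV, hV', by simpa using ringKrullDim_nonneg_of_nontrivial⟩
  | succ n ih =>
    intro K _ f P hP hker
    have h01 : P 0 < P 1 := hP Fin.zero_lt_one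
    obtain ⟨V, hV, hV'⟩ := exists_center f (P 1).asIdeal (hker.trans_le h01.le)
    let g : D →+* ResidueField V := (residue V).comp (f.codRestrict V.toSubring hV)
    have hg : RingHom.ker g = (P 1).asIdeal := by
      ext d
      rw [← hV', RingHom.mem_ker, ← residue_eq_zero_iff]
      rfl
    -- The induction moves from `K` to the residue field of `V`: `g` has kernel `P 1`, so the chain
    -- without `P 0` is admissible for it.
    obtain ⟨W, hW, hW', hdim⟩ := ih g (fun i => P i.succ)
      (fun i j h => hP (Fin.succ_lt_succ_iff.2 h)) hg
    have hmem : ∀ d, f d ∈ V.composite W := fun d =>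
      (V.mem_composite_iff W (x := ⟨f d, hV d⟩)).2 (hW d)
    refine ⟨V.composite W, hmem, fun d => ?_, ?_⟩
    · rw [← Fin.succ_last, ← hW', mem_maximalIdeal, mem_maximalIdeal, _root_.mem_nonunits_iff,
        _root_.mem_nonunits_iff, ← isUnit_compositeResidue_iff]
      rfl
    · obtain ⟨d, hd1, hd0⟩ := SetLike.exists_of_lt (show (P 0).asIdeal < (P 1).asIdeal from h01)
      have hr : (⟨f d, hmem d⟩ : V.composite W) ∈ nonZeroDivisors (V.composite W) := by
        refine mem_nonZeroDivisors_of_ne_zero fun h => hd0 ?_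
        rw [← hker]
        exact congrArg Subtype.val h
      have hr0 : V.compositeResidue W ⟨f d, hmem d⟩ = 0 := by
        refine Subtype.ext ?_
        rw [← hg] at hd1
        exact hd1
      have := ringKrullDim_succ_le_of_surjective _ (V.compositeResidue_surjective W) hr hr0
      rw [Nat.cast_succ]
      exact (add_le_add_left hdim 1).trans this

end ValuationSubring

end

namespace SemistarOperation

/-! ### Quasi-ideals of finite type and quasi-maximal ideals -/

section QuasiIdeal

variable {D : Type u} {K : Type v} [CommRing D] [Field K] [Algebra D K]

theorem coeSubmodule_ne_bot [FaithfulSMul D K] {I : Ideal D} (hI : I ≠ ⊥) :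
    IsLocalization.coeSubmodule K I ≠ ⊥ := by
  obtain ⟨x, hx, hx0⟩ := Submodule.exists_mem_ne_zero_of_ne_bot hI
  intro h
  have : algebraMap D K x ∈ (⊥ : Submodule D K) :=
    h ▸ (IsLocalization.mem_coeSubmodule K I).2 ⟨x, hx, rfl⟩
  exact hx0 ((FaithfulSMul.algebraMap_eq_zero_iff D K).1 ((Submodule.mem_bot D).1 this))

/-- The ideal `I^⋆ ∩ D`. -/
def quasiClosure (s : SemistarOperation D K) (I : Ideal D) : Ideal D :=
  (s (IsLocalization.coeSubmodule K I)).comap (Algebra.linearMap D K)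

theorem mem_quasiClosure (s : SemistarOperation D K) (I : Ideal D) (x : D) :
    x ∈ s.quasiClosure I ↔ algebraMap D K x ∈ s (IsLocalization.coeSubmodule K I) := Iff.rfl

theorem le_quasiClosure (s : SemistarOperation D K) (I : Ideal D) : I ≤ s.quasiClosure I :=
  fun x hx => s.le_star' _ ((IsLocalization.mem_coeSubmodule K I).2 ⟨x, hx, rfl⟩)

theorem isQuasiIdeal_of_quasiClosure_le (s : SemistarOperation D K) {I : Ideal D} (hI : I ≠ ⊥)
    (h : s.quasiClosure I ≤ I) : s.IsQuasiIdeal I :=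
  ⟨hI, le_antisymm h (s.le_quasiClosure I)⟩

theorem isQuasiIdeal_quasiClosure (s : SemistarOperation D K) {I : Ideal D} (hI : I ≠ ⊥) :
    s.IsQuasiIdeal (s.quasiClosure I) := by
  refine s.isQuasiIdeal_of_quasiClosure_le
    (fun h => hI (le_bot_iff.1 (h ▸ s.le_quasiClosure I))) fun x hx => ?_
  have hle : IsLocalization.coeSubmodule K (s.quasiClosure I) ≤
      s (IsLocalization.coeSubmodule K I) := by
    intro y hy
    obtain ⟨z, hz, rfl⟩ := (IsLocalization.mem_coeSubmodule K _).1 hy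
    exact hz
  have := s.mono' hle hx
  rwa [s.idem'] at this

/-- A directed union of quasi-`⋆_f`-ideals is a quasi-`⋆_f`-ideal. -/
theorem isQuasiIdeal_sSup_of_directedOn (s : SemistarOperation D K) {c : Set (Ideal D)}
    (hc : c.Nonempty) (hdir : DirectedOn (· ≤ ·) c)
    (h : ∀ I ∈ c, s.finiteType.IsQuasiIdeal I) : s.finiteType.IsQuasiIdeal (sSup c) := by
  obtain ⟨I, hI⟩ := hc
  refine s.finiteType.isQuasiIdeal_of_quasiClosure_le
    (fun h0 => (h I hI).1 (le_bot_iff.1 (h0 ▸ le_sSup hI))) fun x hx => ?_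
  obtain ⟨F, hF, hFc, hx⟩ := (s.mem_unionFG _ _).1 hx
  have hcoe : IsLocalization.coeSubmodule K (sSup c) =
      sSup ((IsLocalization.coeSubmodule K) '' c) := by
    rw [sSup_image]
    exact (Submodule.gc_map_comap (Algebra.linearMap D K)).l_sSup
  rw [hcoe] at hFc
  have hmono : Monotone (fun J : Ideal D => IsLocalization.coeSubmodule K J) :=
    fun _ _ h => Submodule.map_mono h
  -- `F` is finitely generated, hence compact, so it already lies in one member of the directed
  -- family.
  obtain ⟨_, ⟨J, hJ, rfl⟩, hFJ⟩ :=
    (CompleteLattice.isCompactElement_iff_le_of_directed_sSup_le _ _).1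
      ((Submodule.fg_iff_compact F).1 hF) _ ((Set.nonempty_of_mem hI).image _)
      (directedOn_image.2 (hdir.mono fun _ _ h => hmono h)) hFc
  refine le_sSup hJ ?_
  rw [← (h J hJ).2]
  exact ⟨F, hF, hFJ, hx⟩

theorem one_notMem_of_isQuasiIdeal (s : SemistarOperation D K) {I : Ideal D}
    (hI : s.IsQuasiIdeal I) (hI' : I ≠ ⊤) : (1 : K) ∉ s (IsLocalization.coeSubmodule K I) := by
  intro h
  refine hI' ((Ideal.eq_top_iff_one I).2 ?_)
  rw [← hI.2]
  simpa using h

/-- Every proper quasi-`⋆_f`-ideal is contained in a quasi-`⋆_f`-maximal ideal. -/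
theorem exists_le_isQuasiMaximal (s : SemistarOperation D K) {I : Ideal D}
    (hI : s.finiteType.IsQuasiIdeal I) (hI' : I ≠ ⊤) :
    ∃ M ∈ s.finiteType.QMax, I ≤ M.asIdeal := by
  obtain ⟨M, hIM, hM⟩ := zorn_le_nonempty₀ {J : Ideal D | s.finiteType.IsQuasiIdeal J ∧ J ≠ ⊤}
    (fun c hc hchain J hJ => ⟨sSup c, ⟨s.isQuasiIdeal_sSup_of_directedOn ⟨J, hJ⟩
      hchain.directedOn fun I hI => (hc hI).1, fun htop => by
        obtain ⟨I, hI, h1⟩ := (Submodule.mem_sSup_of_directed ⟨J, hJ⟩ hchain.directedOn).1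
          (htop ▸ Submodule.mem_top : (1 : D) ∈ sSup c)
        exact (hc hI).2 ((Ideal.eq_top_iff_one I).2 h1)⟩, fun _ => le_sSup⟩) I ⟨hI, hI'⟩
  exact ⟨⟨M, IsQuasiMaximal.isPrime hM⟩, hM, hIM⟩

/-- A nonzero ideal contained in no quasi-`⋆_f`-maximal ideal contains a finitely generated `F`
with `1 ∈ F^⋆`. -/
theorem exists_fg_one_mem (s : SemistarOperation D K) {I : Ideal D} (hI : I ≠ ⊥)
    (h : ∀ M ∈ s.finiteType.QMax, ¬ I ≤ M.asIdeal) :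
    ∃ F : Submodule D K, F.FG ∧ F ≤ IsLocalization.coeSubmodule K I ∧ (1 : K) ∈ s F := by
  have htop : s.finiteType.quasiClosure I = ⊤ := by
    by_contra hne
    obtain ⟨M, hM, hle⟩ :=
      s.exists_le_isQuasiMaximal (s.finiteType.isQuasiIdeal_quasiClosure hI) hne
    exact h M hM ((s.finiteType.le_quasiClosure I).trans hle)
  have h1 : (1 : D) ∈ s.finiteType.quasiClosure I := htop ▸ Submodule.mem_top
  rw [mem_quasiClosure, map_one] at h1
  exact h1

/-- Having `K` itself available keeps the supremum `valuativeDim` from being `⊥`. -/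
theorem isValuationOverring_top (s : SemistarOperation D K) : s.IsValuationOverring ⊤ := by
  refine ⟨fun _ => trivial, fun F _ hF0 x _ => ?_⟩
  obtain ⟨y, hy, hy0⟩ := Submodule.exists_mem_ne_zero_of_ne_bot hF0
  have := Submodule.smul_mem _ (⟨x * y⁻¹, ValuationSubring.mem_top _⟩ : (⊤ : ValuationSubring K))
    (Submodule.subset_span hy)
  change x * y⁻¹ * y ∈ _ at this
  rwa [inv_mul_cancel_right₀ hy0] at this

theorem valuativeDim_nonneg (s : SemistarOperation D K) : 0 ≤ s.valuativeDim :=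
  le_iSup₂_of_le ⊤ s.isValuationOverring_top ringKrullDim_nonneg_of_nontrivial

end QuasiIdeal

/-! ### Spectral operations: `dim ≤ valuativeDim`, and centers of valuation overrings -/

section Spectral

variable {D : Type u} {K : Type v} [CommRing D] [IsDomain D] [Field K] [Algebra D K]
  [IsFractionRing D K]

theorem mem_spectral (Δ : Set (PrimeSpectrum D)) {E : Submodule D K} (hE : E ≠ ⊥) (x : K) :
    x ∈ spectral Δ E ↔ ∀ M ∈ Δ, ∃ t : D, t ∉ M.asIdeal ∧ t • x ∈ E := by
  change x ∈ (if E = ⊥ then ⊥ else ⨅ P ∈ Δ, extendAt P E) ↔ _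
  rw [if_neg hE]
  simp only [Submodule.mem_iInf, mem_extendAt]

theorem algebraMap_mem_coeSubmodule {I : Ideal D} {x : D} :
    algebraMap D K x ∈ IsLocalization.coeSubmodule K I ↔ x ∈ I := by
  rw [IsLocalization.mem_coeSubmodule]
  constructor
  · rintro ⟨y, hy, h⟩
    exact FaithfulSMul.algebraMap_injective D K h ▸ hy
  · exact fun h => ⟨x, h, rfl⟩

/-- A denominator showing `1 ∈ I D_M` is the same thing as an element of `I` outside `M`. -/
theorem one_mem_spectral_coeSubmodule (Δ : Set (PrimeSpectrum D)) {I : Ideal D} (hI : I ≠ ⊥) :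
    (1 : K) ∈ spectral Δ (IsLocalization.coeSubmodule K I) ↔ ∀ M ∈ Δ, ¬ I ≤ M.asIdeal := by
  rw [mem_spectral Δ (coeSubmodule_ne_bot hI)]
  refine forall₂_congr fun M _ => ?_
  rw [SetLike.not_le_iff_exists]
  refine exists_congr fun t => ?_
  rw [← Algebra.algebraMap_eq_smul_one, algebraMap_mem_coeSubmodule, and_comm]

/-- The quasi-`⋆_Δ`-primes are the nonzero primes contained in a member of `Δ`. -/
theorem mem_QSpec_spectral (Δ : Set (PrimeSpectrum D)) (P : PrimeSpectrum D) :
    P ∈ (spectral (K := K) Δ).QSpec ↔ P.asIdeal ≠ ⊥ ∧ ∃ M ∈ Δ, P ≤ M := by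
  constructor
  · intro h
    refine ⟨h.2.1, ?_⟩
    by_contra! hcon
    exact one_notMem_of_isQuasiIdeal _ h.2 P.isPrime.ne_top
      ((one_mem_spectral_coeSubmodule Δ h.2.1).2 hcon)
  · rintro ⟨h0, M, hM, hle⟩
    refine ⟨P.isPrime, isQuasiIdeal_of_quasiClosure_le _ h0 fun x hx => ?_⟩
    obtain ⟨t, ht, htx⟩ := (mem_spectral Δ (coeSubmodule_ne_bot h0) _).1 hx M hM
    rw [Algebra.linearMap_apply, Algebra.smul_def, ← map_mul, algebraMap_mem_coeSubmodule] at htx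
    exact (P.isPrime.mem_or_mem htx).resolve_left fun h => ht (hle h)

/-- A valuation ring centered at a prime contained in a member of `Δ` is a `⋆_Δ`-valuation
overring. -/
theorem isValuationOverring_spectral (Δ : Set (PrimeSpectrum D)) {M : PrimeSpectrum D}
    (hM : M ∈ Δ) (V : ValuationSubring K) (hV : ∀ d, algebraMap D K d ∈ V)
    (hVM : ∀ d, d ∉ M.asIdeal → IsUnit (⟨algebraMap D K d, hV d⟩ : V)) :
    (spectral (K := K) Δ).IsValuationOverring V := by
  refine ⟨hV, fun F _ hF0 x hx => ?_⟩
  obtain ⟨t, ht, htx⟩ := (mem_spectral Δ hF0 x).1 hx M hM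
  obtain ⟨b, hb⟩ := isUnit_iff_exists_inv.1 (hVM t ht)
  have hb' : algebraMap D K t * b = 1 := congrArg Subtype.val hb
  have hx' : x = b • (t • x) := by
    change x = (b : K) * (t • x)
    rw [Algebra.smul_def, ← mul_assoc, mul_comm (b : K), hb', one_mul]
  rw [hx']
  exact Submodule.smul_mem _ _ (Submodule.subset_span htx)

/-- The length of a chain of primes whose last member lies in a member of `Δ` is at most the
`⋆_Δ`-valuative dimension. -/
theorem length_le_valuativeDim_spectral (Δ : Set (PrimeSpectrum D)) {M : PrimeSpectrum D}
    (hM : M ∈ Δ) (c : LTSeries (PrimeSpectrum D)) (hc : c.last ≤ M) (h0 : c.head.asIdeal = ⊥) :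
    (c.length : WithBot ℕ∞) ≤ (spectral (K := K) Δ).valuativeDim := by
  obtain ⟨V, hV, hcen, hdim⟩ := ValuationSubring.exists_center_of_chain c.length
    (algebraMap D K) c.toFun c.strictMono (by
      rw [(RingHom.injective_iff_ker_eq_bot _).1 (FaithfulSMul.algebraMap_injective D K)]
      exact h0.symm)
  refine le_iSup₂_of_le V (isValuationOverring_spectral Δ hM V hV fun d hd => ?_) hdim
  by_contra hu
  exact hd (hc ((hcen d).1 hu))

theorem dim_spectral_le_valuativeDim (Δ : Set (PrimeSpectrum D)) :
    ((spectral (K := K) Δ).dim : WithBot ℕ∞) ≤ (spectral (K := K) Δ).valuativeDim := by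
  obtain ⟨n, hn⟩ := WithBot.ne_bot_iff_exists.1
    (ne_bot_of_le_ne_bot WithBot.zero_ne_bot (valuativeDim_nonneg (spectral (K := K) Δ)))
  rw [← hn, WithBot.coe_le_coe]
  refine iSup₂_le fun P hP => iSup₂_le fun c hc => ?_
  rw [← WithBot.coe_le_coe, hn]
  obtain ⟨_, M, hM, hPM⟩ := (mem_QSpec_spectral Δ P).1 hP
  let c' : LTSeries (PrimeSpectrum D) := c.map Subtype.val fun _ _ h => h
  have hlast : c'.last ≤ M := hc.trans hPM
  -- The chains in `height` need not start at zero; prepending the zero ideal only lengthens them.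
  by_cases h0 : c'.head.asIdeal = ⊥
  · exact length_le_valuativeDim_spectral Δ hM c' hlast h0
  · have hlt : (⟨⊥, Ideal.isPrime_bot⟩ : PrimeSpectrum D) < c'.head := 
      lt_of_le_of_ne (show ⊥ ≤ c'.head.asIdeal from bot_le) fun h => h0 (h ▸ rfl)
    refine le_trans ?_ (length_le_valuativeDim_spectral Δ hM (c'.cons _ hlt) ?_ ?_)
    · have : c.length ≤ (c'.cons _ hlt).length := by
        rw [RelSeries.cons_length]
        exact Nat.le_succ _
      exact_mod_cast this
    · rwa [RelSeries.last_cons]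
    · rw [RelSeries.head_cons]

/-- The center on `D` of a nontrivial `⋆̃`-valuation overring is contained in a quasi-`⋆_f`-maximal
ideal. -/
theorem exists_center_le_QMax (s : SemistarOperation D K) (V : ValuationSubring K)
    (hV : s.tilde.IsValuationOverring V) {I : Ideal D} (hI : I ≠ ⊥)
    (hIV : ∀ d ∈ I, (⟨algebraMap D K d, hV.1 d⟩ : V) ∈ IsLocalRing.maximalIdeal V) :
    ∃ M ∈ s.finiteType.QMax, I ≤ M.asIdeal := by
  by_contra! hcon
  obtain ⟨F, hF, hFI, h1⟩ := s.exists_fg_one_mem hI hcon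
  have hF0 : F ≠ ⊥ := by
    rintro rfl
    rw [s.map_bot] at h1
    exact one_ne_zero ((Submodule.mem_bot D).1 h1)
  -- If `F` were inside some quasi-`⋆_f`-maximal `M`, then `1 ∈ F^⋆` would put `1` in `M^{⋆_f}`. So
  -- `F` escapes every such `M`.
  have h1t : (1 : K) ∈ s.tilde F := by
    refine (mem_spectral _ hF0 _).2 fun M hM => ?_
    have hMq : s.finiteType.IsQuasiMaximal M.asIdeal := hM
    by_contra! hFM
    refine one_notMem_of_isQuasiIdeal s.finiteType hMq.prop.1 M.isPrime.ne_top
      ((s.mem_unionFG _ _).2 ⟨F, hF, fun y hy => ?_, h1⟩)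
    obtain ⟨d, hd, rfl⟩ := (IsLocalization.mem_coeSubmodule K I).1 (hFI hy)
    refine algebraMap_mem_coeSubmodule.2 ?_
    by_contra hdM
    exact hFM d hdM (by rwa [← Algebra.algebraMap_eq_smul_one])
  -- The generators of `FV` come from `I`, so `F^⋆̃ ⊆ FV` would place `1` in the maximal ideal of
  -- `V`.
  have hle : Submodule.span V (F : Set K) ≤
      Submodule.map (Algebra.linearMap V K) (IsLocalRing.maximalIdeal V) := by
    refine Submodule.span_le.2 fun y hy => ?_
    obtain ⟨d, hd, rfl⟩ := (IsLocalization.mem_coeSubmodule K I).1 (hFI hy)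
    exact ⟨_, hIV d hd, rfl⟩
  obtain ⟨m, hm, hm1⟩ := hle (hV.2 F hF hF0 h1t)
  have : m = 1 := Subtype.ext hm1
  exact (IsLocalRing.maximalIdeal.isMaximal V).ne_top ((Ideal.eq_top_iff_one _).2 (this ▸ hm))

end Spectral

end SemistarOperation

/-! ### Finitely generated overrings and `valuativeDim ≤ dim` -/

theorem extensionTrdeg_eq_zero (D : Type u) (T : Type w) [CommRing D] [IsDomain D]
    [CommRing T] [IsDomain T] [Algebra D T] [FaithfulSMul D T] [Algebra.IsAlgebraic D T] :
    extensionTrdeg D T = 0 := by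
  let : Algebra (FractionRing D) (FractionRing T) :=
    FractionRing.liftAlgebra D (FractionRing T)
  have := FractionRing.isScalarTower_liftAlgebra D (FractionRing T)
  have : Algebra.IsAlgebraic T (FractionRing T) :=
    (IsFractionRing.comap_isAlgebraic_iff (K := FractionRing T)).2 inferInstance
  have : Algebra.IsAlgebraic D (FractionRing T) := Algebra.IsAlgebraic.trans D T _
  have : Algebra.IsAlgebraic (FractionRing D) (FractionRing T) :=
    (IsFractionRing.comap_isAlgebraic_iff (A := D)).1 inferInstance
  change Cardinal.toENat (Algebra.trdeg (FractionRing D) (FractionRing T)) = 0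
  rw [trdeg_eq_zero, map_zero]

/-- A strict chain of primes of an overring `V ⊆ K` of `D` contracts to a strict chain in some
finitely generated `D`-subalgebra of `V`. -/
theorem exists_subalgebra_strictMono {D : Type u} {K : Type v} [CommRing D] [Field K]
    [Algebra D K] (V : ValuationSubring K) (hV : ∀ d : D, algebraMap D K d ∈ V)
    (c : LTSeries (PrimeSpectrum V)) :
    ∃ (T : Subalgebra D K) (hT : T.toSubring ≤ V.toSubring), T.FG ∧
      StrictMono fun i => PrimeSpectrum.comap (Subring.inclusion hT) (c i) := by
  -- One element separating each consecutive pair of primes; adjoining these finitely many elements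
  -- to `D` keeps every step strict after contraction.
  have hex : ∀ i : Fin c.length, ∃ x : V, x ∈ (c i.succ).asIdeal ∧ x ∉ (c i.castSucc).asIdeal :=
    fun i => SetLike.exists_of_lt (show (c i.castSucc).asIdeal < (c i.succ).asIdeal from c.step i)
  choose x hx hx' using hex
  let S : Set K := Set.range fun i => (x i : K)
  have hT : (Algebra.adjoin D S).toSubring ≤ V.toSubring := by
    let V' : Subalgebra D K := { V.toSubring with algebraMap_mem' := hV }
    have : Algebra.adjoin D S ≤ V' := Algebra.adjoin_le (by
      rintro _ ⟨i, rfl⟩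
      exact (x i).2)
    exact this
  refine ⟨Algebra.adjoin D S, hT, Subalgebra.fg_def.2 ⟨S, Set.finite_range _, rfl⟩, ?_⟩
  refine Fin.strictMono_iff_lt_succ.2 fun i => lt_of_le_not_ge ?_ fun hle => ?_
  · exact fun y hy => (show c i.castSucc < c i.succ from c.step i).le hy
  · exact hx' i (hle (show (⟨x i, Algebra.subset_adjoin ⟨i, rfl⟩⟩ :
      Algebra.adjoin D S) ∈ _ from hx i))

namespace SemistarOperation

/-- Every ideal is closed under the identity operation, so all primes of `T` may enter the chains
defining `height`. -/
theorem eq_bot_or_mem_QSpec_identity {T : Type u} {L : Type v} [CommRing T] [Field L]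
    [Algebra T L] [FaithfulSMul T L] (P : PrimeSpectrum T) :
    P.asIdeal = ⊥ ∨ P ∈ (identity T L).QSpec := by
  refine or_iff_not_imp_left.2 fun h =>
    ⟨P.isPrime, isQuasiIdeal_of_quasiClosure_le _ h fun x hx => ?_⟩
  obtain ⟨y, hy, hyx⟩ := (IsLocalization.mem_coeSubmodule L _).1 hx
  exact FaithfulSMul.algebraMap_injective T L hyx ▸ hy

theorem length_le_height_identity {T : Type u} {L : Type v} [CommRing T] [Field L]
    [Algebra T L] [FaithfulSMul T L] (c : LTSeries (PrimeSpectrum T)) :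
    (c.length : ℕ∞) ≤ (identity T L).height c.last := by
  let c' : LTSeries {Q : PrimeSpectrum T // Q.asIdeal = ⊥ ∨ Q ∈ (identity T L).QSpec} :=
    c.map (fun P => ⟨P, eq_bot_or_mem_QSpec_identity P⟩) fun _ _ h => h
  exact le_iSup₂_of_le (f := fun (c : LTSeries {Q : PrimeSpectrum T //
    Q.asIdeal = ⊥ ∨ Q ∈ (identity T L).QSpec}) (_ : c.last.1 ≤ _) => (c.length : ℕ∞)) c'
    le_rfl le_rfl

section

variable {D : Type u} {K : Type v} [CommRing D] [IsDomain D] [Field K] [Algebra D K]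
  [IsFractionRing D K]

/-- Clearing the denominator of a nonzero `y = a / b` in `Q` leaves the nonzero `a = y * b` in `Q ∩
D`. -/
theorem _root_.Subalgebra.under_ne_bot_of_isFractionRing {T : Subalgebra D K} {Q : Ideal T}
    (hQ : Q ≠ ⊥) : Q.under D ≠ ⊥ := by
  obtain ⟨y, hy, hy0⟩ := Submodule.exists_mem_ne_zero_of_ne_bot hQ
  obtain ⟨a, b, hb, hab⟩ := IsFractionRing.div_surjective (A := D) (y : K)
  have hb0 : algebraMap D K b ≠ 0 := by
    simpa using nonZeroDivisors.ne_zero hb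
  rw [div_eq_iff hb0] at hab
  have ha : a ∈ Q.under D := by
    rw [Ideal.mem_comap]
    have : algebraMap D T a = y * algebraMap D T b := Subtype.ext hab
    exact this ▸ Q.mul_mem_right _ hy
  intro h
  have ha0 : a = 0 := by rwa [h] at ha
  rw [ha0, map_zero] at hab
  exact mul_ne_zero (fun h => hy0 (Subtype.ext h)) hb0 hab.symm

end

variable {D K : Type u} [CommRing D] [IsDomain D] [Field K] [Algebra D K] [IsFractionRing D K]

theorem length_le_dim_tilde (s : SemistarOperation D K)
    (hineq : s.tilde.DimensionInequalityFormula) (V : ValuationSubring K)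
    (hV : s.tilde.IsValuationOverring V) (c : LTSeries (PrimeSpectrum V)) :
    (c.length : ℕ∞) ≤ s.tilde.dim := by
  -- The formula applies only to nonzero `Q`; positive length ensures that the top prime is nonzero.
  rcases Nat.eq_zero_or_pos c.length with h0 | hpos
  · rw [h0]; exact zero_le
  obtain ⟨T, hT, hfg, hmono⟩ := exists_subalgebra_strictMono V hV.1 c
  have : Algebra.FiniteType D T := (Subalgebra.fg_iff_finiteType T).1 hfg
  have : Algebra.IsAlgebraic D K := (IsFractionRing.comap_isAlgebraic_iff (K := K)).2 inferInstance
  have : Algebra.IsAlgebraic D T :=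
    Algebra.IsAlgebraic.of_injective T.val Subtype.val_injective
  let c' : LTSeries (PrimeSpectrum T) := LTSeries.mk c.length _ hmono
  have hlast0 : c'.last.asIdeal ≠ ⊥ := by
    intro h
    have hlt : c'.head < c'.last := hmono (show (0 : Fin (c.length + 1)) < Fin.last _ from
      Fin.lt_def.2 hpos)
    exact hlt.not_ge (show c'.last.asIdeal ≤ c'.head.asIdeal from h ▸ bot_le)
  have hP0 : c'.last.asIdeal.under D ≠ ⊥ := Subalgebra.under_ne_bot_of_isFractionRing hlast0
  -- The top prime of the chain in `V` lies in the maximal ideal, so its trace on `D` lies in the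
  -- center of `V`.
  obtain ⟨M, hM, hle⟩ := s.exists_center_le_QMax V hV hP0 fun d hd =>
    IsLocalRing.le_maximalIdeal c.last.isPrime.ne_top hd
  have hP : PrimeSpectrum.comap (algebraMap D T) c'.last ∈ s.tilde.QSpec :=
    (mem_QSpec_spectral _ _).2 ⟨hP0, M, hM, hle⟩
  have hstar : s.tilde (IsLocalization.coeSubmodule K (c'.last.asIdeal.under D)) <
      s.tilde (IsLocalization.coeSubmodule K (⊤ : Ideal D)) := by
    refine lt_of_le_of_ne (s.tilde.mono' (Submodule.map_mono le_top)) fun h => ?_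
    refine one_notMem_of_isQuasiIdeal s.tilde hP.2 hP.1.ne_top (h.ge (s.tilde.le_star' _ ?_))
    exact (IsLocalization.mem_coeSubmodule K _).2 ⟨1, trivial, map_one _⟩
  have hQ : c'.last ∈ (identity T (FractionRing T)).QSpec :=
    (eq_bot_or_mem_QSpec_identity _).resolve_left hlast0
  -- The formula quantifies over rings in the universe of `D`; `T` qualifies because `K` shares that
  -- universe.
  have key := hineq T c'.last hQ hstar
  rw [extensionTrdeg_eq_zero, add_zero] at key
  calc (c.length : ℕ∞) ≤ (identity T (FractionRing T)).height c'.last :=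
        length_le_height_identity c'
    -- The residue transcendence degree is nonnegative and is discarded.
    _ ≤ _ := le_self_add
    _ ≤ _ := key
    _ ≤ s.tilde.dim := le_iSup₂_of_le _ hP le_rfl

theorem valuativeDim_tilde_le_dim (s : SemistarOperation D K)
    (hineq : s.tilde.DimensionInequalityFormula) :
    s.tilde.valuativeDim ≤ s.tilde.dim :=
  iSup₂_le fun V hV => iSup_le fun c => by
    exact_mod_cast s.length_le_dim_tilde hineq V hV c

end SemistarOperation

theorem theorem2p6 {D K : Type u} [CommRing D] [IsDomain D] [Field K] [Algebra D K]
    [IsFractionRing D K] (s : SemistarOperation D K)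
    (hfin : s.tilde.dim < ⊤) (hineq : s.tilde.DimensionInequalityFormula) :
    (s.tilde.dim : WithBot ℕ∞) = s.tilde.valuativeDim ∧ s.tilde.IsJaffard := by
  have h : (s.tilde.dim : WithBot ℕ∞) = s.tilde.valuativeDim :=
    le_antisymm (SemistarOperation.dim_spectral_le_valuativeDim _)
      (s.valuativeDim_tilde_le_dim hineq)
  -- Finiteness enters only here, for the Jaffard property; the equality holds without it.
  exact ⟨h, h, h ▸ WithBot.coe_lt_coe.2 hfin⟩
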